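/- Let $a,b\ge 1$ be integers, let $n=ab$, and consider the $a\times b$ rectangular Young diagram ($a$ rows, $b$ columns, English notation, row $1$ being the highest row). Write $[k]_q=\frac{1-q^k}{1-q}=1+q+\cdots+q^{k-1}$. A standard Young tableau (SYT) of this shape is a filling $T$ of its boxes with the numbers $1,\dots,n$, each appearing once, increasing along rows and down columns. A descent of $T$ is an entry $i$ such that $i+1$ appears in a strictly higher row than $i$; $\mathrm{Des}(T)$ is the set of descents, and $\mathrm{comaj}(T)=\sum_{i\in \mathrm{Des}(T)}(n-i)$. A standard barely set-valued tableau of this shape is a filling $S$ of the boxes with non-empty sets of numbers from $\{1,\dots,n+1\}$, each of these numbers appearing in exactly one box, such that $\max S(u)<\min S(v)$ whenever $u\neq v$ and the box $u$ is weakly northwest of the box $v$. Thus exactly one box contains two numbers; let $i_*(S)$ be the larger of these two. A barely set-valued descent of $S$ is a number $i\in\{1,\dots,n+1\}$ such that $i+1$ appears in a strictly higher row than $i$, except that $i_*(S)-1$ is never a descent and $i_*(S)$ is always a descent. Let $\mathrm{Des}^{+1}(S)$ be the set of these descents and $\mathrm{comaj}^{+1}(S)=\sum_{i\in \mathrm{Des}^{+1}(S)}(n+1-i)$.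 **Theorem.** For all $a,b\ge 1$, $$\sum_{S} q^{\mathrm{comaj}^{+1}(S)}=\frac{[a]_q[b]_q}{[a+b]_q}\cdot[ab+1]_q\cdot\sum_{T} q^{\mathrm{comaj}(T)}$$ as an identity of rational functions in the indeterminate $q$ over $\mathbb{Q}$, where $S$ runs over the standard barely set-valued tableaux and $T$ over the standard Young tableaux of shape $a\times b$. -/

import Mathlib

open Finset

namespace BarelySetValued

/-- The `a × b` rectangular Young diagram `(b^a)`: `a` rows of length `b`. As everywhere in
Mathlib's `YoungDiagram`, a box is a pair `(row, column)` in matrix coordinates, numbered from `0`,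
with row `0` the highest row. -/
def rect (a b : ℕ) : YoungDiagram where
  cells := range a ×ˢ range b
  isLowerSet := by
    intro u v hvu hu
    simp only [coe_product, coe_range, Set.mem_prod, Set.mem_Iio] at hu ⊢
    exact ⟨lt_of_le_of_lt hvu.1 hu.1, lt_of_le_of_lt hvu.2 hu.2⟩

variable {μ : YoungDiagram}

/-- `T` is a standard Young tableau of shape `μ`, where `n = μ.card` is the number of boxes: a filling
of the boxes with the numbers `1, …, n`, each appearing once, increasing along rows (left to right)
and down columns. -/
structure IsSYT (T : μ.cells → ℕ) : Prop where
  mem_Icc : ∀ u, T u ∈ Icc 1 μ.card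
  existsUnique : ∀ k ∈ Icc 1 μ.card, ∃! u, T u = k
  row_lt : ∀ u v : μ.cells, u.1.1 = v.1.1 → u.1.2 < v.1.2 → T u < T v
  col_lt : ∀ u v : μ.cells, u.1.2 = v.1.2 → u.1.1 < v.1.1 → T u < T v

open scoped Classical in
/-- The finite set of all standard Young tableaux of shape `μ`. -/
noncomputable def SYT (μ : YoungDiagram) : Finset (μ.cells → ℕ) :=
  (Fintype.piFinset fun _ => Icc 1 μ.card).filter IsSYT

/-- The (natural) descents of a tableau `T`: the entries `i` such that `i + 1` appears in a strictly
higher row than `i`. -/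
def descents (T : μ.cells → ℕ) : Finset ℕ :=
  {i ∈ Icc 1 μ.card | ∃ u v : μ.cells, T u = i ∧ T v = i + 1 ∧ v.1.1 < u.1.1}

/-- The (natural) comajor index `∑ (n - i)` over the descents `i ≤ n`. -/
def comaj (T : μ.cells → ℕ) : ℕ := ∑ i ∈ descents T, (μ.card - i)

/-- `S` is a standard barely set-valued tableau of shape `μ`, where `n = μ.card`: a filling of the
boxes with nonempty sets of numbers among `1, …, n + 1`, each number appearing once, such that
`max (S u) < min (S v)` whenever the box `u` is (weakly) northwest of the box `v ≠ u`. -/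
structure IsBarelySYT (S : μ.cells → Finset ℕ) : Prop where
  subset_Icc : ∀ u, S u ⊆ Icc 1 (μ.card + 1)
  nonempty : ∀ u, (S u).Nonempty
  existsUnique : ∀ k ∈ Icc 1 (μ.card + 1), ∃! u, k ∈ S u
  lt : ∀ u v : μ.cells, u.1.1 ≤ v.1.1 → u.1.2 ≤ v.1.2 → u ≠ v → ∀ x ∈ S u, ∀ y ∈ S v, x < y

open scoped Classical in
/-- The finite set of all standard barely set-valued tableaux of shape `μ`. -/
noncomputable def BarelySYT (μ : YoungDiagram) : Finset (μ.cells → Finset ℕ) :=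
  (Fintype.piFinset fun _ => (Icc 1 (μ.card + 1)).powerset).filter IsBarelySYT

/-- The ambient finite set in `SYT` loses no tableau. -/
theorem mem_SYT {T : μ.cells → ℕ} : T ∈ SYT μ ↔ IsSYT T := by
  simp only [SYT, mem_filter, Fintype.mem_piFinset, and_iff_right_iff_imp]
  exact fun h => h.mem_Icc

/-- The ambient finite set in `BarelySYT` loses no tableau. -/
theorem mem_BarelySYT {S : μ.cells → Finset ℕ} : S ∈ BarelySYT μ ↔ IsBarelySYT S := by
  simp only [BarelySYT, mem_filter, Fintype.mem_piFinset, mem_powerset, and_iff_right_iff_imp]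
  exact fun h => h.subset_Icc

/-- `i_*(S)`: the larger of the two numbers in the box of `S` that contains two numbers. (A barely
set-valued tableau has exactly one such box, so the outer supremum is over a single box.) -/
def iStar (S : μ.cells → Finset ℕ) : ℕ :=
  ({u : μ.cells | (S u).card = 2} : Finset μ.cells).sup fun u => (S u).sup id

/-- The barely set-valued descents of `S`: the numbers `i` among `1, …, n + 1` such that `i + 1`
appears in a strictly higher row than `i`, except that `i_*(S) - 1` is never a descent and `i_*(S)`
is always a descent. -/
def barelyDescents (S : μ.cells → Finset ℕ) : Finset ℕ :=
  {i ∈ Icc 1 (μ.card + 1) | i + 1 ≠ iStar S ∧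
    (i = iStar S ∨ ∃ u v : μ.cells, i ∈ S u ∧ i + 1 ∈ S v ∧ v.1.1 < u.1.1)}

/-- The barely set-valued comajor index `∑ (n + 1 - i)` over the descents `i ≤ n + 1`. -/
def barelyComaj (S : μ.cells → Finset ℕ) : ℕ :=
  ∑ i ∈ barelyDescents S, (μ.card + 1 - i)

/-- The `q`-number `[k]_q = 1 + q + ⋯ + q^(k-1)`. -/
def qNumber {R : Type*} [Semiring R] (q : R) (k : ℕ) : R := ∑ i ∈ range k, q ^ i

end BarelySetValued

/-!
The identity is an expectation computation for a random order ideal of the rectangle.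

Let `n = a * b`. A barely set-valued tableau is a linear extension of the rectangle, together with a
*cut* `c` (the number `i_*`) and a box `p` that is maximal in the order ideal of boxes listed before
the cut: the box `p` receives both its own number and that of the cut (`sum_BarelySYT`). The special
rules for the descents `i_* - 1` and `i_*` say exactly that `c` is a letter larger than all others,
so that `barelyComaj` is the ordinary comajor index of a word with `n + 1` letters
(`barelyComaj_toBarely`). Thus the left-hand side sums the number of removable corners of the ideal
before the cut, over all linear extensions with a cut.

*Passing to sequences.* Sorting sequences `f` of natural numbers (ties broken by the letters), the
sequences with a given sorting permutation have generating function `q ^ comaj / ∏ (1 - q ^ i)`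
(`tsum_sort`). So weighted sums over linear extensions with a cut become sums over order-preserving
fillings of the rectangle by natural numbers, together with one free value `j` for the cut, of
`q ^ (sum of all values)`. This is done for `q < 1` in `ℝ≥0∞`, where no convergence question
arises, and transferred to formal `q` because the finite identities are between polynomials
(`natPolynomial_ext`). It gives two facts.
* The value of the cut is free, which contributes `1 / (1 - q)`; hence linear extensions with a cut
  have `[n + 1]` times the generating function of linear extensions (`genFun_cut`).
* Exchanging the value `v` of a box `p` with `j`, as `(v, j) ↦ (j + 1, v)`, is a bijection from the
  fillings where `p` can be removed from the ideal to those where `p` can be added, and it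
  multiplies the weight by `q` (`toggleEquiv`, `genFun_canAdd`).

*Corners.* For every order ideal of the rectangle, `[a + b]` times the number of removable corners is
`[a][b]` plus a combination, with coefficients depending only on the box, of the differences
(addable) - `q` (removable) (`sum_corners`). By the toggle symmetry these differences vanish in the
weighted sum, which leaves `[a][b]` times the generating function of linear extensions with a cut
(`sum_genFun_canRemove`).
-/

namespace BarelySetValued

open scoped ENNReal NNReal

/-! ### The fundamental lemma on sorting sequences -/

/-- The descent indicator of the word `σ 0, σ 1, …` at position `j`: it is `1` if the letter at
position `j` is smaller than the letter just before it, and `0` otherwise (so it is `0` at `j = 0`). -/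
def dropAt {N : ℕ} (σ : Equiv.Perm (Fin N)) (j : Fin N) : ℕ :=
  if ∃ i : Fin N, i.val + 1 = j.val ∧ σ j < σ i then 1 else 0

/-- The comajor index of the word `σ 0, σ 1, …`. A descent between the positions `j - 1` and `j`,
counted from `0`, has weight `N - j`. -/
def permComaj {N : ℕ} (σ : Equiv.Perm (Fin N)) : ℕ := ∑ j, (N - j.val) * dropAt σ j

/-- The sequence whose sorting permutation is `σ` and whose successive increments, once sorted, are
`g j + dropAt σ j`. -/
def ofIncrements {N : ℕ} (σ : Equiv.Perm (Fin N)) (g : Fin N → ℕ) (x : Fin N) : ℕ :=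
  ∑ j ∈ Iic (σ.symm x), (g j + dropAt σ j)

theorem lt_of_dropAt_eq_zero {N : ℕ} (σ : Equiv.Perm (Fin N)) (i j : Fin N) (hij : i < j)
    (h : ∀ k, i < k → k ≤ j → dropAt σ k = 0) : σ i < σ j := by
  obtain ⟨j, hj⟩ := j
  induction j with
  | zero => exact absurd hij (by simp [Fin.le_def])
  | succ j ih =>
    have hstep : σ ⟨j, by omega⟩ < σ ⟨j + 1, hj⟩ := by
      have h0 := h ⟨j + 1, hj⟩ hij le_rfl
      simp only [dropAt, ite_eq_right_iff, one_ne_zero, imp_false, not_exists, not_and, not_lt] at h0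
      refine lt_of_le_of_ne (h0 ⟨j, by omega⟩ rfl) fun he => ?_
      have := σ.injective he
      simp at this
    rcases eq_or_lt_of_le (Nat.lt_succ_iff.mp hij : i.val ≤ j) with he | hl
    · have : i = ⟨j, by omega⟩ := Fin.ext he
      rwa [this]
    · refine (ih (by omega) hl fun k hk hk' => h k hk ?_).trans hstep
      exact hk'.trans (by simp [Fin.le_def])

theorem ofIncrements_apply {N : ℕ} (σ : Equiv.Perm (Fin N)) (g : Fin N → ℕ) (i : Fin N) :
    ofIncrements σ g (σ i) = ∑ j ∈ Iic i, (g j + dropAt σ j) := by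
  simp [ofIncrements]

theorem sum_Iic_eq_add {N : ℕ} (f : Fin N → ℕ) (i : Fin N) :
    ∑ j ∈ Iic i, f j = (∑ j ∈ Iio i, f j) + f i := by
  rw [← Iio_insert, sum_insert (by simp), add_comm]

/-- The partial sums increase strictly wherever the word `σ` has a descent, so that ties occur only
along ascending runs of `σ`. -/
theorem sort_ofIncrements {N : ℕ} (σ : Equiv.Perm (Fin N)) (g : Fin N → ℕ) :
    Tuple.sort (ofIncrements σ g) = σ := by
  symm
  rw [Tuple.eq_sort_iff]
  constructor
  · intro i j hij
    simp only [Function.comp, ofIncrements_apply]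
    exact sum_le_sum_of_subset (Iic_subset_Iic.2 hij)
  · intro i j hij h
    rw [ofIncrements_apply, ofIncrements_apply] at h
    refine lt_of_dropAt_eq_zero σ i j hij fun k hik hkj => ?_
    by_contra hk
    have : ∑ j ∈ insert k (Iic i), (g j + dropAt σ j) ≤ ∑ j ∈ Iic j, (g j + dropAt σ j) := by
      refine sum_le_sum_of_subset ?_
      intro l hl
      simp only [mem_insert, mem_Iic] at hl ⊢
      rcases hl with rfl | hl
      · exact hkj
      · exact hl.trans hij.le
    rw [sum_insert (by simpa using hik)] at this
    omega

theorem ofIncrements_injective {N : ℕ} (σ : Equiv.Perm (Fin N)) :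
    Function.Injective (ofIncrements σ) := by
  intro g g' h
  have hs : ∀ i, ∑ j ∈ Iic i, (g j + dropAt σ j) = ∑ j ∈ Iic i, (g' j + dropAt σ j) := fun i => by
    rw [← ofIncrements_apply, ← ofIncrements_apply, h]
  funext i
  induction i using WellFoundedLT.induction with
  | ind i ih =>
    have := hs i
    rw [sum_Iic_eq_add, sum_Iic_eq_add,
      sum_congr rfl fun j hj => by rw [ih j (by simpa using hj)]] at this
    omega

theorem exists_ofIncrements {N : ℕ} (f : Fin N → ℕ) :
    ∃ g, ofIncrements (Tuple.sort f) g = f := by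
  set σ := Tuple.sort f with hσ
  obtain ⟨hm, hs⟩ := Tuple.eq_sort_iff.1 hσ
  refine ⟨fun i => f (σ i) - (if h : 0 < i.val then f (σ ⟨i.val - 1, by omega⟩) else 0)
    - dropAt σ i, ?_⟩
  suffices h : ∀ k (hk : k < N), ofIncrements σ _ (σ ⟨k, hk⟩) = f (σ ⟨k, hk⟩) by
    funext x
    have := h (σ.symm x).val (σ.symm x).isLt
    simpa using this
  intro k hk
  induction k with
  | zero =>
    rw [ofIncrements_apply, sum_Iic_eq_add]
    have h1 : (Iio (⟨0, hk⟩ : Fin N)) = ∅ := by ext x; simp [Fin.lt_def]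
    have h2 : dropAt σ ⟨0, hk⟩ = 0 := by simp [dropAt]
    simp [h1, h2]
  | succ k ih =>
    have ih := ih (by omega)
    rw [ofIncrements_apply] at ih ⊢
    rw [sum_Iic_eq_add]
    have h1 : (Iio (⟨k + 1, hk⟩ : Fin N)) = Iic ⟨k, by omega⟩ := by
      ext x; simp [Fin.lt_def, Fin.le_def]
    rw [h1, ih]
    have hle : f (σ ⟨k, by omega⟩) ≤ f (σ ⟨k + 1, hk⟩) := hm (by simp [Fin.le_def])
    -- at a descent of `σ` the sorted sequence increases strictly, as ties are sorted by position
    have hd : f (σ ⟨k, by omega⟩) + dropAt σ ⟨k + 1, hk⟩ ≤ f (σ ⟨k + 1, hk⟩) := by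
      by_cases hdrop : ∃ i : Fin N, i.val + 1 = k + 1 ∧ σ ⟨k + 1, hk⟩ < σ i
      · obtain ⟨i, hi, hlt⟩ := hdrop
        rw [show i = ⟨k, by omega⟩ from Fin.ext (by simpa using hi)] at hlt
        have hne : f (σ ⟨k, by omega⟩) ≠ f (σ ⟨k + 1, hk⟩) := fun he =>
          absurd (hs _ _ (by simp [Fin.lt_def]) he) hlt.not_gt
        have : dropAt σ ⟨k + 1, hk⟩ ≤ 1 := by unfold dropAt; split_ifs <;> simp
        omega
      · have : dropAt σ ⟨k + 1, hk⟩ = 0 := by simp only [dropAt]; rw [if_neg hdrop]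
        omega
    simp only [Nat.succ_pos, dif_pos, Nat.add_sub_cancel]
    omega

/-- Every sequence is sorted by a unique permutation and has unique increments. -/
noncomputable def sortEquiv (N : ℕ) : Equiv.Perm (Fin N) × (Fin N → ℕ) ≃ (Fin N → ℕ) :=
  Equiv.ofBijective (fun p => ofIncrements p.1 p.2) <| by
    constructor
    · rintro ⟨σ, g⟩ ⟨τ, h⟩ he
      have hst : σ = τ := by
        rw [← sort_ofIncrements σ g, ← sort_ofIncrements τ h]
        exact congrArg _ he
      subst hst
      exact congrArg _ (ofIncrements_injective σ he)
    · intro f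
      obtain ⟨g, hg⟩ := exists_ofIncrements f
      exact ⟨(Tuple.sort f, g), hg⟩

theorem sum_ofIncrements {N : ℕ} (σ : Equiv.Perm (Fin N)) (g : Fin N → ℕ) :
    ∑ x, ofIncrements σ g x = permComaj σ + ∑ j, (N - j.val) * g j := by
  rw [← Equiv.sum_comp σ]
  simp only [ofIncrements_apply]
  have h : ∀ i : Fin N, ∑ j ∈ Iic i, (g j + dropAt σ j) =
      ∑ j, if j ≤ i then g j + dropAt σ j else 0 := fun i => by
    rw [← sum_filter]; congr 1; ext j; simp
  simp only [h]
  rw [sum_comm, permComaj, ← sum_add_distrib]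
  refine sum_congr rfl fun j _ => ?_
  rw [← sum_filter, sum_const, smul_eq_mul]
  have : ({i | j ≤ i} : Finset (Fin N)) = Ici j := by ext; simp
  rw [this, Fin.card_Ici]
  ring

/-- Distributivity of a finite product over infinite sums. -/
theorem tsum_pi_prod {N : ℕ} (F : Fin N → ℕ → ℝ≥0∞) :
    ∑' g : Fin N → ℕ, ∏ j, F j (g j) = ∏ j, ∑' k, F j k := by
  induction N with
  | zero => simp
  | succ N ih =>
    rw [← (Fin.insertNthEquiv (fun _ => ℕ) 0).tsum_eq, ENNReal.tsum_prod', Fin.prod_univ_succ,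
      ← ih, ← ENNReal.tsum_mul_right]
    refine tsum_congr fun k => ?_
    rw [← ENNReal.tsum_mul_left]
    refine tsum_congr fun g => ?_
    rw [Fin.prod_univ_succ]
    simp

/-- The factor `∏ (1 - q ^ i)⁻¹`, over `1 ≤ i ≤ N`, of the fundamental lemma. -/
noncomputable def geomProd (q : ℝ≥0∞) (N : ℕ) : ℝ≥0∞ := ∏ i ∈ range N, (1 - q ^ (i + 1))⁻¹

/-- The generating function of all sequences whose sorting permutation is weighted by `G`. -/
theorem tsum_sort {N : ℕ} (q : ℝ≥0∞) (G : Equiv.Perm (Fin N) → ℝ≥0∞) :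
    ∑' f : Fin N → ℕ, G (Tuple.sort f) * q ^ ∑ x, f x =
      (∑ σ, G σ * q ^ permComaj σ) * geomProd q N := by
  rw [← (sortEquiv N).tsum_eq, ENNReal.tsum_prod', tsum_fintype, sum_mul]
  refine sum_congr rfl fun σ _ => ?_
  have h : ∀ g, G (Tuple.sort (sortEquiv N (σ, g))) * q ^ ∑ x, sortEquiv N (σ, g) x =
      G σ * q ^ permComaj σ * ∏ j : Fin N, (q ^ (N - j.val)) ^ g j := fun g => by
    change G (Tuple.sort (ofIncrements σ g)) * q ^ ∑ x, ofIncrements σ g x = _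
    rw [sort_ofIncrements, sum_ofIncrements, pow_add, ← mul_assoc, ← prod_pow_eq_pow_sum]
    simp only [pow_mul]
  simp only [h]
  rw [ENNReal.tsum_mul_left, tsum_pi_prod fun j k => (q ^ (N - j.val)) ^ k]
  simp only [ENNReal.tsum_geometric]
  congr 1
  rw [geomProd, prod_range, ← Equiv.prod_comp Fin.revPerm]
  refine prod_congr rfl fun j _ => ?_
  rw [Fin.revPerm_apply, Fin.val_rev, show N - (N - (j.val + 1)) = j.val + 1 by omega]

/-- Sorting puts `x` before `y` when `(f x, x)` is lexicographically smaller than `(f y, y)`. -/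
theorem sort_symm_lt_iff {N : ℕ} (f : Fin N → ℕ) {x y : Fin N} (hxy : x < y) :
    (Tuple.sort f).symm x < (Tuple.sort f).symm y ↔ f x ≤ f y := by
  obtain ⟨hm, hs⟩ := Tuple.eq_sort_iff.1 (rfl : Tuple.sort f = Tuple.sort f)
  set σ := Tuple.sort f
  constructor
  · intro h
    simpa using hm h.le
  · intro h
    by_contra hlt
    have hlt : σ.symm y < σ.symm x :=
      lt_of_le_of_ne (not_lt.1 hlt) fun he => hxy.ne' (σ.symm.injective he)
    have h1 : f y ≤ f x := by simpa using hm hlt.le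
    have h2 := hs _ _ hlt (by simpa using le_antisymm h1 h)
    simp only [Equiv.apply_symm_apply] at h2
    exact h2.not_gt hxy

/-! ### Linear extensions with a cut, and toggles -/

open scoped Classical in
/-- The comajor index generating function of the permutations `w` satisfying `A`. Here `w` gives the
position of each letter, so that the word itself is `w.symm`. -/
noncomputable def genFun {R : Type*} [Semiring R] {N : ℕ} (q : R)
    (A : Equiv.Perm (Fin N) → Prop) : R :=
  ∑ w, if A w then q ^ permComaj w.symm else 0

/-- `w` lists the letters in an order compatible with the relation `r`. -/
def IsLinExt {n : ℕ} (r : Fin n → Fin n → Prop) (w : Equiv.Perm (Fin n)) : Prop :=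
  ∀ i j, r i j → w i < w j

/-- `w` lists the letters of `Fin n` in an order compatible with the relation `r`, together with one
more letter, the cut `Fin.last n`, at an arbitrary position. The letters before the cut form an
order ideal. -/
def IsCutLinExt {n : ℕ} (r : Fin n → Fin n → Prop) (w : Equiv.Perm (Fin (n + 1))) : Prop :=
  ∀ i j, r i j → w (Fin.castSucc i) < w (Fin.castSucc j)

/-- `p` is a maximal element of the order ideal of letters before the cut. -/
def CanRemove {n : ℕ} (r : Fin n → Fin n → Prop) (p : Fin n) (w : Equiv.Perm (Fin (n + 1))) :
    Prop :=
  w (Fin.castSucc p) < w (Fin.last n) ∧ ∀ u, r p u → w (Fin.last n) < w (Fin.castSucc u)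

/-- `p` is a minimal element of the complement of the order ideal of letters before the cut. -/
def CanAdd {n : ℕ} (r : Fin n → Fin n → Prop) (p : Fin n) (w : Equiv.Perm (Fin (n + 1))) :
    Prop :=
  w (Fin.last n) < w (Fin.castSucc p) ∧ ∀ u, r u p → w (Fin.castSucc u) < w (Fin.last n)

theorem tsum_indicator_sort {N : ℕ} (q : ℝ≥0∞) (A : Equiv.Perm (Fin N) → Prop) :
    ∑' f : Fin N → ℕ, {f | A (Tuple.sort f).symm}.indicator (fun f => q ^ ∑ x, f x) f =
      genFun q A * geomProd q N := by
  classical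
  have h := tsum_sort q fun σ : Equiv.Perm (Fin N) => if A σ.symm then 1 else 0
  have hinv : genFun q A = ∑ σ : Equiv.Perm (Fin N), if A σ.symm then q ^ permComaj σ else 0 :=
    (Equiv.sum_comp (Equiv.inv (Equiv.Perm (Fin N)))
      fun w => if A w then q ^ permComaj w.symm else 0).symm
  rw [hinv]
  simp only [ite_mul, one_mul, zero_mul] at h
  rw [← h]
  refine tsum_congr fun f => ?_
  simp [Set.indicator_apply]

theorem isLinExt_sort_iff {n : ℕ} {r : Fin n → Fin n → Prop} (hr : ∀ i j, r i j → i < j)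
    (f : Fin n → ℕ) : IsLinExt r (Tuple.sort f).symm ↔ ∀ i j, r i j → f i ≤ f j :=
  forall₂_congr fun i j => imp_congr_right fun h => sort_symm_lt_iff f (hr i j h)

theorem isCutLinExt_sort_iff {n : ℕ} {r : Fin n → Fin n → Prop} (hr : ∀ i j, r i j → i < j)
    (f : Fin (n + 1) → ℕ) : IsCutLinExt r (Tuple.sort f).symm ↔
      ∀ i j, r i j → f (Fin.castSucc i) ≤ f (Fin.castSucc j) :=
  forall₂_congr fun i j => imp_congr_right fun h =>
    sort_symm_lt_iff f (Fin.castSucc_lt_castSucc_iff.2 (hr i j h))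

theorem last_lt_sort_iff {n : ℕ} (f : Fin (n + 1) → ℕ) (u : Fin n) :
    (Tuple.sort f).symm (Fin.last n) < (Tuple.sort f).symm (Fin.castSucc u) ↔
      f (Fin.last n) < f (Fin.castSucc u) := by
  rw [← not_le, ← not_le, ← sort_symm_lt_iff f (Fin.castSucc_lt_last u), not_iff_not,
    le_iff_lt_or_eq]
  simp only [or_iff_left_iff_imp]
  exact fun h => absurd ((Tuple.sort f).symm.injective h) (Fin.castSucc_lt_last u).ne

/-- The sequences whose cut linear extension allows `p` to be removed from the ideal. -/
def removeSet {n : ℕ} (r : Fin n → Fin n → Prop) (p : Fin n) : Set (Fin (n + 1) → ℕ) :=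
  {f | IsCutLinExt r (Tuple.sort f).symm ∧ CanRemove r p (Tuple.sort f).symm}

/-- The sequences whose cut linear extension allows `p` to be added to the ideal. -/
def addSet {n : ℕ} (r : Fin n → Fin n → Prop) (p : Fin n) : Set (Fin (n + 1) → ℕ) :=
  {f | IsCutLinExt r (Tuple.sort f).symm ∧ CanAdd r p (Tuple.sort f).symm}

theorem mem_removeSet {n : ℕ} {r : Fin n → Fin n → Prop} (hr : ∀ i j, r i j → i < j) {p : Fin n}
    {f : Fin (n + 1) → ℕ} : f ∈ removeSet r p ↔
      (∀ i j, r i j → f (Fin.castSucc i) ≤ f (Fin.castSucc j)) ∧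
      f (Fin.castSucc p) ≤ f (Fin.last n) ∧ ∀ u, r p u → f (Fin.last n) < f (Fin.castSucc u) := by
  simp only [removeSet, Set.mem_ofPred_eq, isCutLinExt_sort_iff hr, CanRemove, last_lt_sort_iff,
    sort_symm_lt_iff f (Fin.castSucc_lt_last _)]

theorem mem_addSet {n : ℕ} {r : Fin n → Fin n → Prop} (hr : ∀ i j, r i j → i < j) {p : Fin n}
    {f : Fin (n + 1) → ℕ} : f ∈ addSet r p ↔
      (∀ i j, r i j → f (Fin.castSucc i) ≤ f (Fin.castSucc j)) ∧
      f (Fin.last n) < f (Fin.castSucc p) ∧ ∀ u, r u p → f (Fin.castSucc u) ≤ f (Fin.last n) := by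
  simp only [addSet, Set.mem_ofPred_eq, isCutLinExt_sort_iff hr, CanAdd, last_lt_sort_iff,
    sort_symm_lt_iff f (Fin.castSucc_lt_last _)]

/-- The sequence with the value `x` at `p`, the value `y` at the cut, and otherwise equal to `f`. -/
def setTwo {n : ℕ} (p : Fin n) (x y : ℕ) (f : Fin (n + 1) → ℕ) : Fin (n + 1) → ℕ :=
  Fin.snoc (Function.update (fun i => f (Fin.castSucc i)) p x) y

@[simp] theorem setTwo_last {n : ℕ} (p : Fin n) (x y : ℕ) (f : Fin (n + 1) → ℕ) :
    setTwo p x y f (Fin.last n) = y := by simp [setTwo]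

theorem setTwo_castSucc {n : ℕ} (p : Fin n) (x y : ℕ) (f : Fin (n + 1) → ℕ) (i : Fin n) :
    setTwo p x y f (Fin.castSucc i) = if i = p then x else f (Fin.castSucc i) := by
  simp [setTwo, Function.update_apply]

theorem setTwo_setTwo {n : ℕ} (p : Fin n) (x y x' y' : ℕ) (f : Fin (n + 1) → ℕ) :
    setTwo p x y (setTwo p x' y' f) = setTwo p x y f := by
  funext i
  refine Fin.lastCases ?_ (fun i => ?_) i
  · simp
  · simp only [setTwo_castSucc]; split_ifs <;> rfl

theorem setTwo_self {n : ℕ} (p : Fin n) (f : Fin (n + 1) → ℕ) :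
    setTwo p (f (Fin.castSucc p)) (f (Fin.last n)) f = f := by
  funext i
  refine Fin.lastCases ?_ (fun i => ?_) i
  · simp
  · rw [setTwo_castSucc]; split_ifs with h
    · rw [h]
    · rfl

theorem sum_setTwo {n : ℕ} (p : Fin n) (x y : ℕ) (f : Fin (n + 1) → ℕ) :
    ∑ i, setTwo p x y f i = (∑ i ∈ univ.erase p, f (Fin.castSucc i)) + x + y := by
  rw [Fin.sum_univ_castSucc, setTwo_last, ← sum_erase_add _ _ (mem_univ p), setTwo_castSucc,
    if_pos rfl]
  congr 2
  refine sum_congr rfl fun i hi => ?_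
  rw [setTwo_castSucc, if_neg (ne_of_mem_erase hi)]

/-- Exchanging the value `v` at `p` with the value `j` of the cut, as `(v, j) ↦ (j + 1, v)`, turns the
sequences where `p` can be removed into those where it can be added. The values between which `v`
is confined by the neighbours of `p` confine `j` in the same way. -/
def toggleEquiv {n : ℕ} {r : Fin n → Fin n → Prop} (hr : ∀ i j, r i j → i < j) (p : Fin n) :
    removeSet r p ≃ addSet r p where
  toFun f := ⟨setTwo p (f.1 (Fin.last n) + 1) (f.1 (Fin.castSucc p)) f.1, by
    obtain ⟨f, hf⟩ := f
    rw [mem_removeSet hr] at hf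
    obtain ⟨h1, h2, h3⟩ := hf
    rw [mem_addSet hr]
    simp only [setTwo_castSucc, setTwo_last]
    refine ⟨fun i j hij => ?_, by simp; omega, fun u hu => ?_⟩
    · have := h1 i j hij
      have := hr i j hij
      split_ifs with hi hj hj
      · exact le_rfl
      · subst hi; exact h3 _ hij
      · subst hj; omega
      · assumption
    · rw [if_neg (hr u p hu).ne]
      exact h1 u p hu⟩
  invFun f := ⟨setTwo p (f.1 (Fin.last n)) (f.1 (Fin.castSucc p) - 1) f.1, by
    obtain ⟨f, hf⟩ := f
    rw [mem_addSet hr] at hf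
    obtain ⟨h1, h2, h3⟩ := hf
    rw [mem_removeSet hr]
    simp only [setTwo_castSucc, setTwo_last]
    refine ⟨fun i j hij => ?_, by simp; omega, fun u hu => ?_⟩
    · have := h1 i j hij
      have := hr i j hij
      split_ifs with hi hj hj
      · exact le_rfl
      · subst hi; omega
      · subst hj; exact h3 _ hij
      · assumption
    · rw [if_neg (hr p u hu).ne']
      have := h1 p u hu
      omega⟩
  left_inv f := by
    apply Subtype.ext
    simp only [setTwo_setTwo, setTwo_last, setTwo_castSucc, if_true, Nat.add_sub_cancel]
    exact setTwo_self p f.1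
  right_inv f := by
    have h : f.1 (Fin.last n) < f.1 (Fin.castSucc p) := ((mem_addSet hr).1 f.2).2.1
    apply Subtype.ext
    simp only [setTwo_setTwo, setTwo_last, setTwo_castSucc, if_true]
    rw [Nat.sub_add_cancel (by omega)]
    exact setTwo_self p f.1

theorem geomProd_ne_zero (q : ℝ≥0∞) (N : ℕ) : geomProd q N ≠ 0 := by
  rw [geomProd, prod_ne_zero_iff]
  intro i _
  rw [ENNReal.inv_ne_zero]
  exact ENNReal.sub_ne_top ENNReal.one_ne_top

theorem geomProd_ne_top {q : ℝ≥0∞} (hq : q < 1) (N : ℕ) : geomProd q N ≠ ⊤ := by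
  refine ENNReal.prod_ne_top fun i _ => ?_
  rw [ENNReal.inv_ne_top, Ne, tsub_eq_zero_iff_le, not_le]
  exact pow_lt_one₀ zero_le hq (by simp)

theorem genFun_canAdd_of_lt_one {n : ℕ} {r : Fin n → Fin n → Prop} (hr : ∀ i j, r i j → i < j)
    (p : Fin n) {q : ℝ≥0∞} (hq : q < 1) :
    genFun q (fun w => IsCutLinExt r w ∧ CanAdd r p w) =
      q * genFun q (fun w => IsCutLinExt r w ∧ CanRemove r p w) := by
  rw [← ENNReal.mul_left_inj (geomProd_ne_zero q (n + 1)) (geomProd_ne_top hq (n + 1)), mul_assoc,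
    ← tsum_indicator_sort, ← tsum_indicator_sort]
  change ∑' f, (addSet r p).indicator _ f = q * ∑' f, (removeSet r p).indicator _ f
  rw [← _root_.tsum_subtype, ← _root_.tsum_subtype, ← (toggleEquiv hr p).tsum_eq,
    ← ENNReal.tsum_mul_left]
  refine tsum_congr fun f => ?_
  rw [← pow_succ']
  congr 1
  change ∑ x, setTwo p (f.1 (Fin.last n) + 1) (f.1 (Fin.castSucc p)) f.1 x = _
  conv_rhs => rw [← setTwo_self p f.1]
  rw [sum_setTwo, sum_setTwo]
  ring

theorem qNumber_add {R : Type*} [CommSemiring R] (q : R) (a b : ℕ) :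
    qNumber q (a + b) = qNumber q a + q ^ a * qNumber q b := by
  simp only [qNumber, sum_range_add, mul_sum, pow_add]

theorem qNumber_succ {R : Type*} [CommSemiring R] (q : R) (a : ℕ) :
    qNumber q (a + 1) = qNumber q a + q ^ a := by
  rw [qNumber, sum_range_succ]; rfl

theorem inv_one_sub_eq_qNumber_mul {q : ℝ≥0∞} (hq : q < 1) (n : ℕ) :
    (1 - q)⁻¹ = qNumber q (n + 1) * (1 - q ^ (n + 1))⁻¹ := by
  have h : ∀ m, (1 - q) * qNumber q m + q ^ m = 1 := fun m => by
    induction m with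
    | zero => simp [qNumber]
    | succ m ih =>
      rw [qNumber_succ, mul_add, add_assoc, pow_succ', ← add_mul, tsub_add_cancel_of_le hq.le,
        one_mul, ih]
  have h1 : 1 - q ^ (n + 1) = (1 - q) * qNumber q (n + 1) :=
    ENNReal.sub_eq_of_eq_add (by finiteness) (h (n + 1)).symm
  have h0 : qNumber q (n + 1) ≠ 0 := by
    rw [qNumber, sum_range_succ']; simp
  have ht : qNumber q (n + 1) ≠ ⊤ := by
    rw [qNumber]; exact ENNReal.sum_ne_top.2 fun i _ => ENNReal.pow_ne_top hq.ne_top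
  rw [h1, ENNReal.mul_inv (.inr ht) (.inr h0), mul_left_comm, ENNReal.mul_inv_cancel h0 ht, mul_one]

theorem genFun_cut_of_lt_one {n : ℕ} {r : Fin n → Fin n → Prop} (hr : ∀ i j, r i j → i < j)
    {q : ℝ≥0∞} (hq : q < 1) :
    genFun q (IsCutLinExt r) = qNumber q (n + 1) * genFun q (IsLinExt r) := by
  have hG : geomProd q (n + 1) = geomProd q n * (1 - q ^ (n + 1))⁻¹ := by
    rw [geomProd, prod_range_succ]; rfl
  have key : genFun q (IsCutLinExt r) * geomProd q (n + 1) =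
      (1 - q)⁻¹ * (genFun q (IsLinExt r) * geomProd q n) := by
    rw [← tsum_indicator_sort, ← tsum_indicator_sort,
      ← (Fin.insertNthEquiv (fun _ => ℕ) (Fin.last n)).tsum_eq, ENNReal.tsum_prod',
      ← ENNReal.tsum_geometric, ← ENNReal.tsum_mul_right]
    refine tsum_congr fun k => ?_
    rw [← ENNReal.tsum_mul_left]
    refine tsum_congr fun g => ?_
    classical
    simp only [Set.indicator_apply, Set.mem_ofPred_eq, isCutLinExt_sort_iff hr, isLinExt_sort_iff hr,
      Fin.insertNthEquiv_apply, Fin.insertNth_last', Fin.snoc_castSucc, Fin.sum_univ_castSucc,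
      Fin.snoc_last]
    split_ifs
    · rw [pow_add, mul_comm]
    · simp
  rw [inv_one_sub_eq_qNumber_mul hq n] at key
  rw [← ENNReal.mul_left_inj (geomProd_ne_zero q (n + 1)) (geomProd_ne_top hq (n + 1)), key, hG]
  ring

/-- Polynomials with natural coefficients that agree on all extended non-negative `q < 1` are equal. -/
theorem natPolynomial_ext {P Q : Polynomial ℕ}
    (h : ∀ q : ℝ≥0∞, q < 1 → Polynomial.aeval q P = Polynomial.aeval q Q) : P = Q := by
  have hreal : ∀ x : ℝ, x ∈ Set.Ioo (0 : ℝ) 1 → Polynomial.aeval x P = Polynomial.aeval x Q := by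
    intro x hx
    lift x to ℝ≥0 using hx.1.le
    have h1 := h (x : ℝ≥0∞) (by exact_mod_cast hx.2)
    have h2 : ∀ P : Polynomial ℕ, ((Polynomial.aeval x P : ℝ≥0) : ℝ≥0∞) =
        Polynomial.aeval (x : ℝ≥0∞) P := fun P => by
      rw [Polynomial.aeval_def, Polynomial.aeval_def]
      exact (Polynomial.hom_eval₂ P _ ENNReal.ofNNRealHom x).trans
        (by congr 1)
    have h3 : ∀ P : Polynomial ℕ, ((Polynomial.aeval x P : ℝ≥0) : ℝ) =
        Polynomial.aeval (x : ℝ) P := fun P => by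
      rw [Polynomial.aeval_def, Polynomial.aeval_def]
      exact (Polynomial.hom_eval₂ P _ NNReal.toRealHom x).trans
        (by congr 1)
    rw [← h2, ← h2, ENNReal.coe_inj] at h1
    rw [← h3, ← h3, h1]
  refine Polynomial.map_injective (Nat.castRingHom ℝ) Nat.cast_injective ?_
  refine Polynomial.eq_of_infinite_eval_eq _ _ ((Set.Ioo_infinite (zero_lt_one' ℝ)).mono ?_)
  intro x hx
  have := hreal x hx
  rw [Polynomial.aeval_def, Polynomial.aeval_def] at this
  rw [Set.mem_ofPred_eq, Polynomial.eval_map, Polynomial.eval_map]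
  exact this

theorem map_genFun {R S : Type*} [Semiring R] [Semiring S] (φ : R →+* S) {N : ℕ} (q : R)
    (A : Equiv.Perm (Fin N) → Prop) : φ (genFun q A) = genFun (φ q) A := by
  simp only [genFun, map_sum]
  refine sum_congr rfl fun w _ => ?_
  split_ifs <;> simp

theorem map_qNumber {R S : Type*} [Semiring R] [Semiring S] (φ : R →+* S) (q : R) (k : ℕ) :
    φ (qNumber q k) = qNumber (φ q) k := by
  simp [qNumber]

theorem aeval_genFun {R : Type*} [CommSemiring R] {N : ℕ} (q : R)
    (A : Equiv.Perm (Fin N) → Prop) :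
    Polynomial.aeval q (genFun (Polynomial.X : Polynomial ℕ) A) = genFun q A := by
  have := map_genFun (Polynomial.aeval q : Polynomial ℕ →ₐ[ℕ] R).toRingHom Polynomial.X A
  simpa using this

theorem aeval_qNumber {R : Type*} [CommSemiring R] (q : R) (k : ℕ) :
    Polynomial.aeval q (qNumber (Polynomial.X : Polynomial ℕ) k) = qNumber q k := by
  simp [qNumber]

/-- The `q`-toggle-symmetry of cut linear extensions. -/
theorem genFun_canAdd {R : Type*} [CommSemiring R] {n : ℕ} {r : Fin n → Fin n → Prop}
    (hr : ∀ i j, r i j → i < j) (p : Fin n) (q : R) :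
    genFun q (fun w => IsCutLinExt r w ∧ CanAdd r p w) =
      q * genFun q (fun w => IsCutLinExt r w ∧ CanRemove r p w) := by
  have h : genFun (Polynomial.X : Polynomial ℕ) (fun w => IsCutLinExt r w ∧ CanAdd r p w) =
      Polynomial.X * genFun Polynomial.X (fun w => IsCutLinExt r w ∧ CanRemove r p w) :=
    natPolynomial_ext fun x hx => by
      simpa only [map_mul, aeval_genFun, Polynomial.aeval_X] using genFun_canAdd_of_lt_one hr p hx
  have := congrArg (Polynomial.aeval q) h
  simpa only [map_mul, aeval_genFun, Polynomial.aeval_X] using this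

/-- Inserting the cut in all possible ways multiplies the generating function of linear extensions
by `[n + 1]_q`. -/
theorem genFun_cut {R : Type*} [CommSemiring R] {n : ℕ} {r : Fin n → Fin n → Prop}
    (hr : ∀ i j, r i j → i < j) (q : R) :
    genFun q (IsCutLinExt r) = qNumber q (n + 1) * genFun q (IsLinExt r) := by
  have h : genFun (Polynomial.X : Polynomial ℕ) (IsCutLinExt r) =
      qNumber Polynomial.X (n + 1) * genFun Polynomial.X (IsLinExt r) :=
    natPolynomial_ext fun x hx => by
      simpa only [map_mul, aeval_genFun, aeval_qNumber] using genFun_cut_of_lt_one hr hx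
  have := congrArg (Polynomial.aeval q) h
  simpa only [map_mul, aeval_genFun, aeval_qNumber] using this

/-! ### Corners of an order ideal of the rectangle -/

/-- `(x, y)` is a removable corner of the Young diagram `J`. -/
def IsInner (J : YoungDiagram) (x y : ℕ) : Prop :=
  (x, y) ∈ J ∧ (x + 1, y) ∉ J ∧ (x, y + 1) ∉ J

/-- `(x, y)` is an addable corner of the Young diagram `J`. -/
def IsOuter (J : YoungDiagram) (x y : ℕ) : Prop :=
  (x, y) ∉ J ∧ (∀ x', x' + 1 = x → (x', y) ∈ J) ∧ ∀ y', y' + 1 = y → (x, y') ∈ J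

/-- The coefficient of the box `(x, y)` in the expansion of the number of removable corners in terms
of toggles. -/
def cornerCoeff {R : Type*} [CommRing R] (q : R) (a b x y : ℕ) : R :=
  qNumber q a * qNumber q y - q ^ x * qNumber q (a - x) * qNumber q b

/-- The total coefficient of the box `(x, y)` as a removable corner, `[a + b]` included, is that of
an addable corner at its southeast vertex. -/
theorem cornerCoeff_succ {R : Type*} [CommRing R] (q : R) {a x : ℕ} (b y : ℕ) (hx : x < a) :
    cornerCoeff q a b (x + 1) (y + 1) = qNumber q (a + b) + q * cornerCoeff q a b x y := by
  obtain ⟨d, rfl⟩ : ∃ d, a = x + 1 + d := ⟨a - (x + 1), by omega⟩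
  have h1 : x + 1 + d - x = d + 1 := by omega
  have h2 : x + 1 + d - (x + 1) = d := by omega
  have h3 : ∀ m, qNumber q (m + 1) = 1 + q * qNumber q m := fun m => by
    rw [add_comm, qNumber_add]; simp [qNumber]
  rw [cornerCoeff, cornerCoeff, h1, h2, qNumber_add q _ b, h3 y, qNumber_succ q d]
  ring

open scoped Classical in
theorem sum_isInner {R : Type*} [CommRing R] (J : YoungDiagram) (b x : ℕ) (hb : J.rowLen x ≤ b)
    (F : ℕ → R) :
    ∑ y ∈ range b, (if IsInner J x y then F (y + 1) else 0) =
      if J.rowLen (x + 1) < J.rowLen x then F (J.rowLen x) else 0 := by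
  have h : ∀ y, IsInner J x y ↔ y + 1 = J.rowLen x ∧ J.rowLen (x + 1) < J.rowLen x := fun y => by
    simp only [IsInner, YoungDiagram.mem_iff_lt_rowLen]
    omega
  split_ifs with hlt
  · rw [sum_eq_single (J.rowLen x - 1)]
    · rw [if_pos ((h _).2 ⟨by omega, hlt⟩), Nat.sub_add_cancel (by omega)]
    · intro y _ hy
      rw [if_neg fun hc => hy ?_]
      have := (h y).1 hc
      omega
    · intro hn
      simp at hn
      omega
  · refine sum_eq_zero fun y _ => if_neg fun hc => hlt ((h y).1 hc).2

open scoped Classical in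
theorem sum_isOuter {R : Type*} [CommRing R] (J : YoungDiagram) (b x : ℕ) (F : ℕ → R) :
    ∑ y ∈ range b, (if IsOuter J x y then F y else 0) =
      if J.rowLen x < b ∧ ∀ x', x' + 1 = x → J.rowLen x < J.rowLen x' then F (J.rowLen x)
      else 0 := by
  have h : ∀ y, IsOuter J x y ↔
      y = J.rowLen x ∧ ∀ x', x' + 1 = x → J.rowLen x < J.rowLen x' := fun y => by
    simp only [IsOuter, YoungDiagram.mem_iff_lt_rowLen]
    constructor
    · rintro ⟨h1, h2, h3⟩
      have : y = J.rowLen x := by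
        rcases y with _ | y
        · omega
        · have := h3 y rfl; omega
      exact ⟨this, fun x' hx' => this ▸ h2 x' hx'⟩
    · rintro ⟨rfl, h2⟩
      exact ⟨by omega, h2, fun y' hy' => by omega⟩
  split_ifs with hlt
  · rw [sum_eq_single (J.rowLen x)]
    · rw [if_pos ((h _).2 ⟨rfl, hlt.2⟩)]
    · intro y _ hy
      rw [if_neg fun hc => hy ((h y).1 hc).1]
    · intro hn
      simp at hn
      omega
  · refine sum_eq_zero fun y hy => if_neg fun hc => hlt ⟨?_, ((h y).1 hc).2⟩
    have := (h y).1 hc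
    have := mem_range.1 hy
    omega

open scoped Classical in
/-- `[a + b]` times the number of removable corners of `J` is `[a][b]` plus a combination of the
differences between addable and `q` times removable corners. Along the boundary of `J`, the
coefficient of each corner is a function of its row plus a function of its column, and
consecutive corners share one of the two, so that the sum telescopes. -/
theorem sum_corners {R : Type*} [CommRing R] (q : R) {a b : ℕ} (ha : 1 ≤ a) {J : YoungDiagram}
    (hJ : J ≤ rect a b) :
    ∑ x ∈ range a, ∑ y ∈ range b,
      ((if IsInner J x y then qNumber q (a + b) + q * cornerCoeff q a b x y else 0) -
        (if IsOuter J x y then cornerCoeff q a b x y else 0)) = qNumber q a * qNumber q b := by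
  have hmem : ∀ x y, (x, y) ∈ J → x < a ∧ y < b := fun x y h => by
    have : (x, y) ∈ (rect a b).cells := hJ h
    simpa [rect] using this
  have hlen : ∀ x, J.rowLen x ≤ b := fun x => by
    by_contra hc
    exact (hmem x b (YoungDiagram.mem_iff_lt_rowLen.2 (by omega))).2.false
  have hlast : J.rowLen a = 0 := by
    by_contra hc
    exact (hmem a 0 (YoungDiagram.mem_iff_lt_rowLen.2 (by omega))).1.false
  set M : ℕ → R := fun x => if J.rowLen (x + 1) < J.rowLen x then
    cornerCoeff q a b (x + 1) (J.rowLen x) else 0 with hM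
  set Q : ℕ → R := fun x => if J.rowLen x < b ∧ ∀ x', x' + 1 = x → J.rowLen x < J.rowLen x' then
    cornerCoeff q a b x (J.rowLen x) else 0 with hQ
  have hrow : ∀ x ∈ range a, ∑ y ∈ range b,
      ((if IsInner J x y then qNumber q (a + b) + q * cornerCoeff q a b x y else 0) -
        (if IsOuter J x y then cornerCoeff q a b x y else 0)) = M x - Q x := by
    intro x hx
    rw [sum_sub_distrib, hM, hQ]
    simp only [← cornerCoeff_succ q b _ (mem_range.1 hx)]
    rw [sum_isInner J b x (hlen x) fun y => cornerCoeff q a b (x + 1) y,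
      sum_isOuter J b x fun y => cornerCoeff q a b x y]
  rw [sum_congr rfl hrow, sum_sub_distrib]
  obtain ⟨k, rfl⟩ : ∃ k, a = k + 1 := ⟨a - 1, by omega⟩
  have hstep : ∀ x, M x - Q (x + 1) =
      qNumber q (k + 1) * qNumber q (J.rowLen x) -
        qNumber q (k + 1) * qNumber q (J.rowLen (x + 1)) := fun x => by
    have hanti := J.rowLen_anti x (x + 1) (by omega)
    have hx := hlen x
    by_cases hlt : J.rowLen (x + 1) < J.rowLen x
    · simp only [hM, hQ]
      rw [if_pos hlt, if_pos ⟨by omega, fun x' hx' => by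
        rwa [show x' = x by omega]⟩, cornerCoeff, cornerCoeff]
      ring
    · simp only [hM, hQ]
      rw [if_neg hlt, if_neg (fun hc => hlt (hc.2 x rfl)),
        show J.rowLen (x + 1) = J.rowLen x by omega]
      ring
  have hend : M k = qNumber q (k + 1) * qNumber q (J.rowLen k) := by
    simp only [hM]
    rw [hlast]
    split_ifs with h
    · simp [cornerCoeff, qNumber]
    · rw [show J.rowLen k = 0 by omega]; simp [qNumber]
  have hstart : Q 0 = qNumber q (k + 1) * qNumber q (J.rowLen 0) -
      qNumber q (k + 1) * qNumber q b := by
    simp only [hQ]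
    rcases (hlen 0).lt_or_eq with h | h
    · rw [if_pos ⟨h, fun x' hx' => by omega⟩]
      simp [cornerCoeff]
    · rw [if_neg fun hc => hc.1.ne h, h, sub_self]
  rw [sum_range_succ, sum_range_succ']
  have htel : ∑ x ∈ range k, M x - ∑ x ∈ range k, Q (x + 1) =
      qNumber q (k + 1) * qNumber q (J.rowLen 0) - qNumber q (k + 1) * qNumber q (J.rowLen k) := by
    rw [← sum_sub_distrib, sum_congr rfl fun x _ => hstep x]
    exact sum_range_sub' (fun x => qNumber q (k + 1) * qNumber q (J.rowLen x)) k
  rw [hend, hstart]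
  linear_combination htel

variable {μ : YoungDiagram}

/-! ### Tableaux as linear extensions -/

/-- `e` numbers the boxes of `μ` row by row, each row from left to right. -/
def IsRowReading (e : μ.cells ≃ Fin μ.card) : Prop :=
  ∀ u v, e u < e v ↔ u.1.1 < v.1.1 ∨ u.1.1 = v.1.1 ∧ u.1.2 < v.1.2

theorem exists_isRowReading (μ : YoungDiagram) : ∃ e : μ.cells ≃ Fin μ.card, IsRowReading e := by
  set s : Finset (ℕ ×ₗ ℕ) := μ.cells.map toLex.toEmbedding with hs
  have hcard : s.card = μ.card := by rw [hs, card_map]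
  have hmem : ∀ u : ℕ × ℕ, u ∈ μ.cells ↔ toLex u ∈ s := fun u => by simp [hs]
  let f : μ.cells ≃ s := (toLex (α := ℕ × ℕ)).subtypeEquiv hmem
  refine ⟨f.trans (s.orderIsoOfFin hcard).symm.toEquiv, fun u v => ?_⟩
  change (s.orderIsoOfFin hcard).symm (f u) < (s.orderIsoOfFin hcard).symm (f v) ↔ _
  rw [OrderIso.lt_iff_lt]
  exact Prod.Lex.toLex_lt_toLex

/-- The order of the boxes of `μ` (`u < v` if `u ≠ v` is weakly northwest of `v`), transported along
the numbering `e`. -/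
def cellRel (e : μ.cells ≃ Fin μ.card) (i j : Fin μ.card) : Prop := e.symm i < e.symm j

theorem lt_iff_northwest (u v : μ.cells) : u < v ↔ u.1.1 ≤ v.1.1 ∧ u.1.2 ≤ v.1.2 ∧ u ≠ v := by
  rw [lt_iff_le_and_ne, ← and_assoc]
  exact Iff.rfl

theorem cellRel_apply (e : μ.cells ≃ Fin μ.card) (u v : μ.cells) :
    cellRel e (e u) (e v) ↔ u < v := by simp [cellRel]

theorem IsRowReading.lt_of_cellRel {e : μ.cells ≃ Fin μ.card} (he : IsRowReading e)
    (i j : Fin μ.card) (h : cellRel e i j) : i < j := by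
  obtain ⟨u, rfl⟩ := e.surjective i
  obtain ⟨v, rfl⟩ := e.surjective j
  rw [cellRel_apply, lt_iff_northwest] at h
  obtain ⟨h1, h2, h3⟩ := h
  rw [he]
  have : ¬ (u.1.1 = v.1.1 ∧ u.1.2 = v.1.2) := fun hc => h3 (Subtype.ext (Prod.ext hc.1 hc.2))
  omega

theorem IsRowReading.row_lt_iff {e : μ.cells ≃ Fin μ.card} (he : IsRowReading e) {u v : μ.cells}
    (h : ¬ v < u) : v.1.1 < u.1.1 ↔ e v < e u := by
  rw [he]
  refine ⟨Or.inl, fun h' => h'.resolve_right fun h'' => h ?_⟩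
  rw [lt_iff_northwest]
  refine ⟨h''.1.le, h''.2.le, ?_⟩
  rintro rfl
  exact h''.2.false

/-- A sum of weights over a descent set, counted from `1`, is the comajor index of a word. -/
theorem sum_filter_eq_permComaj {N : ℕ} (σ : Equiv.Perm (Fin N)) (D : ℕ → Prop) [DecidablePred D]
    (h : ∀ i (hi : i + 1 < N), D (i + 1) ↔ σ ⟨i + 1, hi⟩ < σ ⟨i, by omega⟩) :
    ∑ i ∈ Icc 1 N with D i, (N - i) = permComaj σ := by
  rw [sum_filter, permComaj]
  rcases N with _ | M
  · simp
  have hI : Icc 1 (M + 1) = (range (M + 1)).map ⟨(· + 1), add_left_injective 1⟩ := by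
    ext x
    simp only [mem_Icc, mem_map, mem_range, Function.Embedding.coeFn_mk]
    exact ⟨fun hx => ⟨x - 1, by omega, by omega⟩, by rintro ⟨y, hy, rfl⟩; omega⟩
  have h0 : dropAt σ 0 = 0 := by simp [dropAt]
  rw [hI, sum_map, sum_range_succ, sum_range, Fin.sum_univ_succ, h0]
  simp only [Function.Embedding.coeFn_mk, Nat.sub_self, ite_self, add_zero, mul_zero,
    zero_add]
  refine sum_congr rfl fun i _ => ?_
  have hd : (∃ k : Fin (M + 1), k.val + 1 = i.succ.val ∧ σ i.succ < σ k) ↔ D (i.val + 1) := by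
    rw [h i.val (by omega)]
    constructor
    · rintro ⟨k, hk, hlt⟩
      rw [show k = ⟨i.val, by omega⟩ from Fin.ext (by simpa using hk)] at hlt
      exact hlt
    · intro hlt
      exact ⟨_, rfl, hlt⟩
  simp only [dropAt, hd]
  split_ifs <;> simp

/-- The filling whose entry in the box `u` is the position, counted from `1`, of the letter `e u`. -/
def toSYT (e : μ.cells ≃ Fin μ.card) (w : Equiv.Perm (Fin μ.card)) (u : μ.cells) : ℕ :=
  (w (e u)).val + 1

theorem isSYT_iff {T : μ.cells → ℕ} : IsSYT T ↔ (∀ u, T u ∈ Icc 1 μ.card) ∧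
    (∀ k ∈ Icc 1 μ.card, ∃! u, T u = k) ∧ ∀ u v, u < v → T u < T v := by
  constructor
  · refine fun h => ⟨h.mem_Icc, h.existsUnique, fun u v huv => ?_⟩
    obtain ⟨h1, h2, h3⟩ := (lt_iff_northwest u v).1 huv
    -- compare both boxes with the one in the row of `u` and the column of `v`
    have hm : (u.1.1, v.1.2) ∈ μ.cells :=
      μ.isLowerSet (show ((u.1.1, v.1.2) : ℕ × ℕ) ≤ v.1 from ⟨h1, le_rfl⟩) v.2
    rcases h1.lt_or_eq with h1 | h1
    · have hc := h.col_lt ⟨_, hm⟩ v rfl h1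
      rcases h2.lt_or_eq with h2 | h2
      · exact (h.row_lt u ⟨_, hm⟩ rfl h2).trans hc
      · exact h.col_lt u v h2 h1
    · refine h.row_lt u v h1 (h2.lt_of_ne fun hc => h3 (Subtype.ext (Prod.ext h1 hc)))
  · rintro ⟨h1, h2, h3⟩
    refine ⟨h1, h2, fun u v h h' => h3 u v ?_, fun u v h h' => h3 u v ?_⟩ <;>
    · rw [lt_iff_northwest]
      refine ⟨by omega, by omega, ?_⟩
      rintro rfl
      exact h'.false

theorem isSYT_toSYT {e : μ.cells ≃ Fin μ.card} {w : Equiv.Perm (Fin μ.card)}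
    (hw : IsLinExt (cellRel e) w) : IsSYT (toSYT e w) := by
  rw [isSYT_iff]
  refine ⟨fun u => ?_, fun k hk => ?_, fun u v huv => ?_⟩
  · simp only [toSYT, mem_Icc]; omega
  · rw [mem_Icc] at hk
    refine ⟨e.symm (w.symm ⟨k - 1, by omega⟩), by simp [toSYT]; omega, fun u hu => ?_⟩
    simp only [toSYT] at hu
    rw [Equiv.eq_symm_apply, Equiv.eq_symm_apply, Fin.ext_iff]
    exact (by omega : (w (e u)).val = k - 1)
  · exact Nat.succ_lt_succ (hw _ _ ((cellRel_apply e u v).2 huv))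

theorem comaj_toSYT {e : μ.cells ≃ Fin μ.card} (he : IsRowReading e)
    {w : Equiv.Perm (Fin μ.card)} (hw : IsLinExt (cellRel e) w) :
    comaj (toSYT e w) = permComaj w.symm := by
  classical
  rw [comaj, descents]
  convert! sum_filter_eq_permComaj w.symm _ ?_
  intro i hi
  have key : ∀ u v, toSYT e w u = i + 1 → toSYT e w v = i + 1 + 1 →
      (v.1.1 < u.1.1 ↔ w.symm ⟨i + 1, hi⟩ < w.symm ⟨i, by omega⟩) := by
    intro u v hu hv
    simp only [toSYT] at hu hv
    have h1 : w.symm ⟨i + 1, hi⟩ = e v := by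
      rw [Equiv.symm_apply_eq, Fin.ext_iff]; exact (by omega : i + 1 = (w (e v)).val)
    have h2 : w.symm ⟨i, by omega⟩ = e u := by
      rw [Equiv.symm_apply_eq, Fin.ext_iff]; exact (by omega : i = (w (e u)).val)
    rw [h1, h2]
    refine he.row_lt_iff fun hlt => ?_
    have := hw _ _ ((cellRel_apply e v u).2 hlt)
    rw [Fin.lt_def] at this
    omega
  constructor
  · rintro ⟨u, v, hu, hv, hlt⟩
    exact (key u v hu hv).1 hlt
  · intro hlt
    have hu : toSYT e w (e.symm (w.symm ⟨i, by omega⟩)) = i + 1 := by simp [toSYT]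
    have hv : toSYT e w (e.symm (w.symm ⟨i + 1, hi⟩)) = i + 1 + 1 := by simp [toSYT]
    exact ⟨_, _, hu, hv, (key _ _ hu hv).2 hlt⟩

theorem exists_toSYT_eq (e : μ.cells ≃ Fin μ.card) {T : μ.cells → ℕ} (hT : IsSYT T) :
    ∃ w, IsLinExt (cellRel e) w ∧ toSYT e w = T := by
  obtain ⟨h1, h2, h3⟩ := isSYT_iff.1 hT
  simp only [mem_Icc] at h1
  let f : Fin μ.card → Fin μ.card := fun i =>
    ⟨T (e.symm i) - 1, by have := h1 (e.symm i); omega⟩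
  have hf : Function.Injective f := by
    intro i j hij
    have hi := h1 (e.symm i)
    have hj := h1 (e.symm j)
    have hval : T (e.symm i) - 1 = T (e.symm j) - 1 := congrArg Fin.val hij
    refine e.symm.injective ((h2 (T (e.symm j)) (mem_Icc.2 hj)).unique ?_ rfl)
    omega
  refine ⟨Equiv.ofBijective f (Finite.injective_iff_bijective.1 hf), fun i j hij => ?_, ?_⟩
  · have := h3 _ _ hij
    have hi := h1 (e.symm i)
    exact (by omega : T (e.symm i) - 1 < T (e.symm j) - 1)
  · funext u
    have := h1 u
    simp only [toSYT, Equiv.ofBijective_apply, f, Equiv.symm_apply_apply]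
    omega

/-- The comajor index generating function of standard Young tableaux, as one of linear extensions. -/
theorem sum_SYT {R : Type*} [CommSemiring R] {e : μ.cells ≃ Fin μ.card} (he : IsRowReading e)
    (q : R) : ∑ T ∈ SYT μ, q ^ comaj T = genFun q (IsLinExt (cellRel e)) := by
  classical
  rw [genFun, ← sum_filter]
  symm
  refine sum_nbij (toSYT e) (fun w hw => ?_) ?_ ?_ fun w hw => ?_
  · exact mem_SYT.2 (isSYT_toSYT (mem_filter.1 hw).2)
  · intro w _ w' _ h
    refine Equiv.ext fun i => Fin.ext ?_
    have := congrFun h (e.symm i)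
    simpa [toSYT] using this
  · intro T hT
    obtain ⟨w, hw, rfl⟩ := exists_toSYT_eq e (mem_SYT.1 hT)
    exact ⟨w, by simpa using hw, rfl⟩
  · rw [comaj_toSYT he (mem_filter.1 hw).2]

/-! ### Barely set-valued tableaux as linear extensions with a cut -/

/-- The set-valued filling whose entries in the box `u` are the position, counted from `1`, of the
letter `e u`, and, if `u = p`, also the position of the cut. -/
def toBarely (e : μ.cells ≃ Fin μ.card) (p : μ.cells) (w : Equiv.Perm (Fin (μ.card + 1)))
    (u : μ.cells) : Finset ℕ :=
  if u = p then {(w (e u).castSucc).val + 1, (w (Fin.last _)).val + 1}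
  else {(w (e u).castSucc).val + 1}

theorem mem_toBarely {e : μ.cells ≃ Fin μ.card} {p : μ.cells} {w : Equiv.Perm (Fin (μ.card + 1))}
    {u : μ.cells} {x : ℕ} : x ∈ toBarely e p w u ↔
      x = (w (e u).castSucc).val + 1 ∨ u = p ∧ x = (w (Fin.last _)).val + 1 := by
  unfold toBarely
  split_ifs with h <;> simp [h]

theorem val_castSucc_ne_val_last {n : ℕ} (w : Equiv.Perm (Fin (n + 1))) (i : Fin n) :
    (w i.castSucc).val ≠ (w (Fin.last n)).val := fun h =>
  (Fin.castSucc_lt_last i).ne (w.injective (Fin.ext h))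

theorem card_toBarely_eq_two {e : μ.cells ≃ Fin μ.card} {p : μ.cells}
    {w : Equiv.Perm (Fin (μ.card + 1))} {u : μ.cells} :
    (toBarely e p w u).card = 2 ↔ u = p := by
  unfold toBarely
  split_ifs with h
  · simp only [h, iff_true]
    rw [card_pair]
    have := val_castSucc_ne_val_last w (e p)
    omega
  · simp [h]

theorem iStar_toBarely {e : μ.cells ≃ Fin μ.card} {p : μ.cells}
    {w : Equiv.Perm (Fin (μ.card + 1))} (hp : CanRemove (cellRel e) (e p) w) :
    iStar (toBarely e p w) = (w (Fin.last _)).val + 1 := by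
  have h : ({u : μ.cells | (toBarely e p w u).card = 2} : Finset μ.cells) = {p} := by
    ext u; simp [card_toBarely_eq_two]
  have hlt := Fin.lt_def.1 hp.1
  rw [iStar, h, sup_singleton, toBarely, if_pos rfl, sup_insert, sup_singleton]
  simp only [id]
  exact sup_eq_right.2 (by omega)

theorem isBarelySYT_toBarely {e : μ.cells ≃ Fin μ.card} {p : μ.cells}
    {w : Equiv.Perm (Fin (μ.card + 1))} (hw : IsCutLinExt (cellRel e) w)
    (hp : CanRemove (cellRel e) (e p) w) : IsBarelySYT (toBarely e p w) := by
  refine ⟨fun u x hx => ?_, fun u => ⟨_, mem_toBarely.2 (Or.inl rfl)⟩, fun k hk => ?_,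
    fun u v h1 h2 h3 x hx y hy => ?_⟩
  · rw [mem_toBarely] at hx
    rw [mem_Icc]
    omega
  · rw [mem_Icc] at hk
    obtain ⟨l, hl⟩ := w.surjective ⟨k - 1, by omega⟩
    have hl : (w l).val = k - 1 := congrArg Fin.val hl
    refine Fin.lastCases (motive := fun l => (w l).val = k - 1 → _) (fun hl => ?_)
      (fun i hl => ?_) l hl
    · refine ⟨p, mem_toBarely.2 (Or.inr ⟨rfl, by omega⟩), fun u hu => ?_⟩
      rcases mem_toBarely.1 hu with hu | hu
      · exact absurd (by omega) (val_castSucc_ne_val_last w (e u))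
      · exact hu.1
    · refine ⟨e.symm i, mem_toBarely.2 (Or.inl (by simp; omega)), fun u hu => ?_⟩
      rcases mem_toBarely.1 hu with hu | hu
      · rw [Equiv.eq_symm_apply]
        exact Fin.castSucc_injective _ (w.injective (Fin.ext (by omega)))
      · exact absurd (by omega) (val_castSucc_ne_val_last w i)
  · have huv : u < v := (lt_iff_northwest u v).2 ⟨h1, h2, h3⟩
    have hlt := Fin.lt_def.1 (hw _ _ ((cellRel_apply e u v).2 huv))
    have hpl := Fin.lt_def.1 hp.1
    rcases mem_toBarely.1 hx with hx | ⟨rfl, hx⟩ <;> rcases mem_toBarely.1 hy with hy | ⟨rfl, hy⟩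
    · omega
    · omega
    · have := Fin.lt_def.1 (hp.2 _ ((cellRel_apply e u v).2 huv))
      omega
    · exact absurd rfl h3

/-- The rules for the descents `i_* - 1` and `i_*` say that the cut is a letter larger than all
others. -/
theorem barelyComaj_toBarely {e : μ.cells ≃ Fin μ.card} (he : IsRowReading e) {p : μ.cells}
    {w : Equiv.Perm (Fin (μ.card + 1))} (hw : IsCutLinExt (cellRel e) w)
    (hp : CanRemove (cellRel e) (e p) w) :
    barelyComaj (toBarely e p w) = permComaj w.symm := by
  classical
  rw [barelyComaj, barelyDescents]
  convert! sum_filter_eq_permComaj w.symm _ ?_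
  intro i hi
  rw [iStar_toBarely hp]
  obtain ⟨l, hl⟩ := w.surjective ⟨i, by omega⟩
  obtain ⟨m, hm⟩ := w.surjective ⟨i + 1, hi⟩
  rw [← hl, ← hm, Equiv.symm_apply_apply, Equiv.symm_apply_apply]
  have hl : (w l).val = i := congrArg Fin.val hl
  have hm : (w m).val = i + 1 := congrArg Fin.val hm
  induction m using Fin.lastCases with
  | last =>
    refine iff_of_false (fun h => h.1 (by omega)) (Fin.le_last l).not_gt
  | cast m =>
    have hne := val_castSucc_ne_val_last w m
    induction l using Fin.lastCases with
    | last =>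
      exact iff_of_true ⟨by omega, Or.inl (by omega)⟩ (Fin.castSucc_lt_last m)
    | cast l =>
      have hne' := val_castSucc_ne_val_last w l
      obtain ⟨u, rfl⟩ := e.surjective l
      obtain ⟨v, rfl⟩ := e.surjective m
      have hrow : v.1.1 < u.1.1 ↔ e v < e u := he.row_lt_iff fun hlt => by
        have := Fin.lt_def.1 (hw _ _ ((cellRel_apply e v u).2 hlt))
        omega
      rw [Fin.castSucc_lt_castSucc_iff, ← hrow]
      constructor
      · rintro ⟨-, h | ⟨u', v', hu', hv', hlt⟩⟩
        · omega
        · have hu : u' = u := by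
            rcases mem_toBarely.1 hu' with h | h
            · exact e.injective (Fin.castSucc_injective _ (w.injective (Fin.ext (by omega))))
            · omega
          have hv : v' = v := by
            rcases mem_toBarely.1 hv' with h | h
            · exact e.injective (Fin.castSucc_injective _ (w.injective (Fin.ext (by omega))))
            · omega
          rwa [hu, hv] at hlt
      · intro hlt
        exact ⟨by omega, Or.inr ⟨u, v, mem_toBarely.2 (Or.inl (by omega)),
          mem_toBarely.2 (Or.inl (by omega)), hlt⟩⟩

theorem toBarely_injective {e : μ.cells ≃ Fin μ.card} {p p' : μ.cells}
    {w w' : Equiv.Perm (Fin (μ.card + 1))} (hp : CanRemove (cellRel e) (e p) w)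
    (hp' : CanRemove (cellRel e) (e p') w') (h : toBarely e p w = toBarely e p' w') :
    p = p' ∧ w = w' := by
  have hpp : p = p' := by
    rw [← card_toBarely_eq_two (e := e) (w := w'), ← h, card_toBarely_eq_two]
  have hlast : (w (Fin.last _)).val = (w' (Fin.last _)).val := by
    have h1 := iStar_toBarely hp
    have h2 := iStar_toBarely hp'
    rw [h] at h1
    omega
  refine ⟨hpp, Equiv.ext fun l => Fin.ext ?_⟩
  induction l using Fin.lastCases with
  | last => exact hlast
  | cast i =>
    obtain ⟨u, rfl⟩ := e.surjective i
    have hu : (w (e u).castSucc).val + 1 ∈ toBarely e p' w' u := by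
      rw [← h]; exact mem_toBarely.2 (Or.inl rfl)
    have hne := val_castSucc_ne_val_last w (e u)
    rcases mem_toBarely.1 hu with h' | h' <;> omega

/-- Every barely set-valued tableau comes from a linear extension with a cut: the larger of the two
numbers sharing a box is the position of the cut. -/
theorem exists_toBarely_eq (e : μ.cells ≃ Fin μ.card) {S : μ.cells → Finset ℕ}
    (hS : IsBarelySYT S) : ∃ p w, IsCutLinExt (cellRel e) w ∧ CanRemove (cellRel e) (e p) w ∧
      toBarely e p w = S := by
  have hIcc : ∀ u, ∀ x ∈ S u, 1 ≤ x ∧ x ≤ μ.card + 1 := fun u x hx =>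
    mem_Icc.1 (hS.subset_Icc u hx)
  have huniq : ∀ u v x, x ∈ S u → x ∈ S v → u = v := fun u v x hu hv =>
    (hS.existsUnique x (hS.subset_Icc u hu)).unique hu hv
  have : Nonempty μ.cells := ⟨(hS.existsUnique 1 (by simp)).choose⟩
  choose! box hbox _ using hS.existsUnique
  -- there are more numbers than boxes, so that two numbers share a box
  obtain ⟨p, k₁, k₂, h1, h2, hlt⟩ : ∃ p k₁ k₂, k₁ ∈ S p ∧ k₂ ∈ S p ∧ k₁ < k₂ := by
    obtain ⟨k₁, hk₁, k₂, hk₂, hne, heq⟩ := exists_ne_map_eq_of_card_lt_of_maps_to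
      (s := Icc 1 (μ.card + 1)) (t := (univ : Finset μ.cells)) (f := box)
      (by simp [YoungDiagram.card]) (fun _ _ => mem_coe.2 (mem_univ _))
    rcases hne.lt_or_gt with hlt | hlt
    · exact ⟨box k₁, k₁, k₂, hbox _ hk₁, heq ▸ hbox _ hk₂, hlt⟩
    · exact ⟨box k₁, k₂, k₁, heq ▸ hbox _ hk₂, hbox _ hk₁, hlt⟩
  choose c hc using hS.nonempty
  let g : μ.cells → ℕ := fun u => if u = p then k₁ else c u
  have hg : ∀ u, g u ∈ S u := fun u => by
    simp only [g]; split_ifs with h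
    · rwa [h]
    · exact hc u
  have hgne : ∀ u, g u ≠ k₂ := fun u hu => by
    have hup : u = p := huniq u p k₂ (hu ▸ hg u) h2
    simp only [g, if_pos hup] at hu
    omega
  let F : Fin (μ.card + 1) → ℕ := Fin.snoc (fun i => g (e.symm i)) k₂
  have hFc : ∀ u, F (e u).castSucc = g u := fun u => by simp [F]
  have hFl : F (Fin.last _) = k₂ := by simp [F]
  have hFI : ∀ l, 1 ≤ F l ∧ F l ≤ μ.card + 1 := fun l => by
    induction l using Fin.lastCases with
    | last => rw [hFl]; exact hIcc p _ h2
    | cast i => obtain ⟨u, rfl⟩ := e.surjective i; rw [hFc]; exact hIcc u _ (hg u)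
  have hFinj : Function.Injective F := by
    intro l m hlm
    induction l using Fin.lastCases with
    | last =>
      induction m using Fin.lastCases with
      | last => rfl
      | cast j =>
        obtain ⟨v, rfl⟩ := e.surjective j
        rw [hFl, hFc] at hlm
        exact absurd hlm.symm (hgne v)
    | cast i =>
      obtain ⟨u, rfl⟩ := e.surjective i
      induction m using Fin.lastCases with
      | last =>
        rw [hFl, hFc] at hlm
        exact absurd hlm (hgne u)
      | cast j =>
        obtain ⟨v, rfl⟩ := e.surjective j
        rw [hFc, hFc] at hlm
        rw [huniq u v (g u) (hg u) (hlm ▸ hg v)]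
  let f : Fin (μ.card + 1) → Fin (μ.card + 1) := fun l => ⟨F l - 1, by have := hFI l; omega⟩
  have hf : Function.Injective f := fun l m hlm => hFinj <| by
    have hval : F l - 1 = F m - 1 := congrArg Fin.val hlm
    have := hFI l
    have := hFI m
    omega
  let w := Equiv.ofBijective f (Finite.injective_iff_bijective.1 hf)
  have hw : ∀ l, (w l).val + 1 = F l := fun l => by
    have := hFI l
    exact (by omega : F l - 1 + 1 = F l)
  have hwc : ∀ u, (w (e u).castSucc).val + 1 = g u := fun u => by rw [hw, hFc]
  have hwl : (w (Fin.last _)).val + 1 = k₂ := by rw [hw, hFl]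
  have hSlt : ∀ u v, u < v → ∀ x ∈ S u, ∀ y ∈ S v, x < y := fun u v huv => by
    obtain ⟨h1, h2, h3⟩ := (lt_iff_northwest u v).1 huv
    exact hS.lt u v h1 h2 h3
  refine ⟨p, w, fun i j hij => ?_, ⟨?_, fun j hj => ?_⟩, ?_⟩
  · obtain ⟨u, rfl⟩ := e.surjective i
    obtain ⟨v, rfl⟩ := e.surjective j
    have := hSlt u v ((cellRel_apply e u v).1 hij) _ (hg u) _ (hg v)
    rw [← hwc, ← hwc] at this
    exact Fin.lt_def.2 (by omega)
  · have hgp : g p = k₁ := if_pos rfl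
    have := hwc p
    exact Fin.lt_def.2 (by omega)
  · obtain ⟨v, rfl⟩ := e.surjective j
    have := hSlt p v ((cellRel_apply e p v).1 hj) _ h2 _ (hg v)
    rw [← hwc, ← hwl] at this
    exact Fin.lt_def.2 (by omega)
  · funext u
    ext x
    rw [mem_toBarely, hwc, hwl]
    constructor
    · rintro (rfl | ⟨rfl, rfl⟩)
      · exact hg u
      · exact h2
    · intro hx
      have hxI := hIcc u x hx
      obtain ⟨l, hl⟩ := w.surjective ⟨x - 1, by omega⟩
      have hl : F l = x := by
        rw [← hw, hl]
        exact (by omega : x - 1 + 1 = x)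
      induction l using Fin.lastCases with
      | last =>
        rw [hFl] at hl
        exact Or.inr ⟨huniq u p x hx (hl ▸ h2), hl.symm⟩
      | cast i =>
        obtain ⟨v, rfl⟩ := e.surjective i
        rw [hFc] at hl
        rw [huniq u v x hx (hl ▸ hg v)]
        exact Or.inl hl.symm

/-- The comajor index generating function of barely set-valued tableaux, as one of linear
extensions with a cut and a marked maximal element of the order ideal before the cut. -/
theorem sum_BarelySYT {R : Type*} [CommSemiring R] {e : μ.cells ≃ Fin μ.card}
    (he : IsRowReading e) (q : R) :
    ∑ S ∈ BarelySYT μ, q ^ barelyComaj S = ∑ p : μ.cells,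
      genFun q (fun w => IsCutLinExt (cellRel e) w ∧ CanRemove (cellRel e) (e p) w) := by
  classical
  have hsum : ∀ p : μ.cells,
      genFun q (fun w => IsCutLinExt (cellRel e) w ∧ CanRemove (cellRel e) (e p) w) =
        ∑ w with IsCutLinExt (cellRel e) w ∧ CanRemove (cellRel e) (e p) w,
          q ^ permComaj w.symm := fun p => by
    rw [genFun, sum_filter]
    exact sum_congr rfl fun w _ => by congr
  simp only [hsum]
  rw [sum_sigma']
  symm
  refine sum_nbij (fun x => toBarely e x.1 x.2) (fun x hx => ?_) ?_ ?_ fun x hx => ?_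
  · have h := (mem_filter.1 (mem_sigma.1 hx).2).2
    exact mem_BarelySYT.2 (isBarelySYT_toBarely h.1 h.2)
  · rintro ⟨p, w⟩ hx ⟨p', w'⟩ hx' h
    have h1 := (mem_filter.1 (mem_sigma.1 hx).2).2
    have h2 := (mem_filter.1 (mem_sigma.1 hx').2).2
    obtain ⟨rfl, rfl⟩ := toBarely_injective h1.2 h2.2 h
    rfl
  · intro S hS
    obtain ⟨p, w, hw, hp, rfl⟩ := exists_toBarely_eq e (mem_BarelySYT.1 hS)
    exact ⟨⟨p, w⟩, by simp [hw, hp], rfl⟩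
  · have h := (mem_filter.1 (mem_sigma.1 hx).2).2
    rw [barelyComaj_toBarely he h.1 h.2]

/-! ### The order ideal before the cut -/

/-- The Young diagram of the boxes whose letters come before the cut. -/
def cutIdeal (e : μ.cells ≃ Fin μ.card) (w : Equiv.Perm (Fin (μ.card + 1)))
    (hw : IsCutLinExt (cellRel e) w) : YoungDiagram where
  cells := ({u : μ.cells | w (e u).castSucc < w (Fin.last _)} : Finset μ.cells).map
    (Function.Embedding.subtype _)
  isLowerSet := by
    intro u v hvu hu
    simp only [coe_map, Set.mem_image, mem_coe, mem_filter, mem_univ, true_and] at hu ⊢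
    obtain ⟨u, hu, rfl⟩ := hu
    refine ⟨⟨v, μ.isLowerSet hvu u.2⟩, ?_, rfl⟩
    rcases (show (⟨v, μ.isLowerSet hvu u.2⟩ : μ.cells) ≤ u from hvu).eq_or_lt with h | h
    · rwa [h]
    · exact (hw _ _ ((cellRel_apply e _ u).2 h)).trans hu

theorem mem_cutIdeal {e : μ.cells ≃ Fin μ.card} {w : Equiv.Perm (Fin (μ.card + 1))}
    {hw : IsCutLinExt (cellRel e) w} (u : μ.cells) :
    u.1 ∈ cutIdeal e w hw ↔ w (e u).castSucc < w (Fin.last _) := by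
  rw [← YoungDiagram.mem_cells]
  simp [cutIdeal]

theorem cutIdeal_le {e : μ.cells ≃ Fin μ.card} {w : Equiv.Perm (Fin (μ.card + 1))}
    (hw : IsCutLinExt (cellRel e) w) : cutIdeal e w hw ≤ μ := by
  intro u hu
  have hu : u ∈ (cutIdeal e w hw).cells := hu
  simp only [cutIdeal, mem_map] at hu
  obtain ⟨u, -, rfl⟩ := hu
  exact u.2

theorem last_lt_iff_notMem_cutIdeal {e : μ.cells ≃ Fin μ.card}
    {w : Equiv.Perm (Fin (μ.card + 1))} (hw : IsCutLinExt (cellRel e) w) (u : μ.cells) :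
    w (Fin.last _) < w (e u).castSucc ↔ u.1 ∉ cutIdeal e w hw := by
  rw [mem_cutIdeal, not_lt, le_iff_lt_or_eq, or_iff_left]
  exact fun h => val_castSucc_ne_val_last w (e u) (congrArg Fin.val h.symm)

theorem canRemove_iff_isInner {e : μ.cells ≃ Fin μ.card} {w : Equiv.Perm (Fin (μ.card + 1))}
    (hw : IsCutLinExt (cellRel e) w) (p : μ.cells) :
    CanRemove (cellRel e) (e p) w ↔ IsInner (cutIdeal e w hw) p.1.1 p.1.2 := by
  have hout : (∀ u, cellRel e (e p) u → w (Fin.last _) < w u.castSucc) ↔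
      ∀ u : ℕ × ℕ, p.1 < u → u ∉ cutIdeal e w hw := by
    constructor
    · intro h u hpu hu
      have hm : u ∈ μ.cells := cutIdeal_le hw hu
      exact (last_lt_iff_notMem_cutIdeal hw ⟨u, hm⟩).1
        (h _ ((cellRel_apply e p ⟨u, hm⟩).2 hpu)) hu
    · intro h u hu
      obtain ⟨u, rfl⟩ := e.surjective u
      exact (last_lt_iff_notMem_cutIdeal hw u).2 (h u.1 ((cellRel_apply e p u).1 hu))
  rw [CanRemove, ← mem_cutIdeal (hw := hw), hout, IsInner]
  refine and_congr Iff.rfl ⟨fun h => ⟨h _ ?_, h _ ?_⟩, fun h u hpu hu => ?_⟩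
  · exact Prod.lt_iff.2 (Or.inl ⟨Nat.lt_succ_self _, le_rfl⟩)
  · exact Prod.lt_iff.2 (Or.inr ⟨le_rfl, Nat.lt_succ_self _⟩)
  · rcases Prod.lt_iff.1 hpu with h' | h'
    · exact h.1 ((cutIdeal e w hw).isLowerSet
        (show ((p.1.1 + 1, p.1.2) : ℕ × ℕ) ≤ u from ⟨h'.1, h'.2⟩) hu)
    · exact h.2 ((cutIdeal e w hw).isLowerSet
        (show ((p.1.1, p.1.2 + 1) : ℕ × ℕ) ≤ u from ⟨h'.1, h'.2⟩) hu)

theorem canAdd_iff_isOuter {e : μ.cells ≃ Fin μ.card} {w : Equiv.Perm (Fin (μ.card + 1))}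
    (hw : IsCutLinExt (cellRel e) w) (p : μ.cells) :
    CanAdd (cellRel e) (e p) w ↔ IsOuter (cutIdeal e w hw) p.1.1 p.1.2 := by
  have hin : (∀ u, cellRel e u (e p) → w u.castSucc < w (Fin.last _)) ↔
      ∀ u : ℕ × ℕ, u < p.1 → u ∈ cutIdeal e w hw := by
    constructor
    · intro h u hup
      have hm : u ∈ μ.cells := μ.isLowerSet hup.le p.2
      exact (mem_cutIdeal ⟨u, hm⟩).2 (h _ ((cellRel_apply e ⟨u, hm⟩ p).2 hup))
    · intro h u hu
      obtain ⟨u, rfl⟩ := e.surjective u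
      exact (mem_cutIdeal u).1 (h u.1 ((cellRel_apply e u p).1 hu))
  rw [CanAdd, last_lt_iff_notMem_cutIdeal hw, hin, IsOuter]
  refine and_congr Iff.rfl ⟨fun h => ⟨fun x hx => h _ ?_, fun y hy => h _ ?_⟩, fun h u hup => ?_⟩
  · exact Prod.lt_iff.2 (Or.inl ⟨by simp; omega, le_rfl⟩)
  · exact Prod.lt_iff.2 (Or.inr ⟨le_rfl, by simp; omega⟩)
  · rcases Prod.lt_iff.1 hup with h' | h'
    · exact (cutIdeal e w hw).isLowerSet
        (show u ≤ ((p.1.1 - 1, p.1.2) : ℕ × ℕ) from ⟨by simp; omega, h'.2⟩)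
        (h.1 (p.1.1 - 1) (by omega))
    · exact (cutIdeal e w hw).isLowerSet
        (show u ≤ ((p.1.1, p.1.2 - 1) : ℕ × ℕ) from ⟨h'.1, by simp; omega⟩)
        (h.2 (p.1.2 - 1) (by omega))

/-- The expected number of removable corners of the order ideal before the cut, for the weight
`q ^ permComaj`. -/
theorem sum_genFun_canRemove {R : Type*} [CommRing R] (q : R) {a b : ℕ} (ha : 1 ≤ a)
    {e : (rect a b).cells ≃ Fin (rect a b).card} (he : IsRowReading e) :
    qNumber q (a + b) * ∑ p, genFun q (fun w => IsCutLinExt (cellRel e) w ∧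
        CanRemove (cellRel e) (e p) w) =
      qNumber q a * qNumber q b * genFun q (IsCutLinExt (cellRel e)) := by
  classical
  have hsplit : ∀ w, IsCutLinExt (cellRel e) w →
      ∑ p, ((if CanRemove (cellRel e) (e p) w then
          qNumber q (a + b) + q * cornerCoeff q a b p.1.1 p.1.2 else 0) -
        (if CanAdd (cellRel e) (e p) w then cornerCoeff q a b p.1.1 p.1.2 else 0)) =
      qNumber q a * qNumber q b := fun w hw => by
    simp only [canRemove_iff_isInner hw, canAdd_iff_isOuter hw]
    rw [← sum_corners q ha (cutIdeal_le hw), ← sum_product' (range a) (range b)]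
    exact sum_coe_sort (range a ×ˢ range b) fun p : ℕ × ℕ =>
      ((if IsInner (cutIdeal e w hw) p.1 p.2 then
          qNumber q (a + b) + q * cornerCoeff q a b p.1 p.2 else 0) -
        (if IsOuter (cutIdeal e w hw) p.1 p.2 then cornerCoeff q a b p.1 p.2 else 0))
  have hterm : ∀ p, qNumber q (a + b) * genFun q (fun w => IsCutLinExt (cellRel e) w ∧
        CanRemove (cellRel e) (e p) w) =
      ∑ w, if IsCutLinExt (cellRel e) w then q ^ permComaj w.symm *
        ((if CanRemove (cellRel e) (e p) w then
            qNumber q (a + b) + q * cornerCoeff q a b p.1.1 p.1.2 else 0) -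
          (if CanAdd (cellRel e) (e p) w then cornerCoeff q a b p.1.1 p.1.2 else 0)) else 0 := by
    intro p
    -- the toggle symmetry makes the two terms with `cornerCoeff` cancel
    have htog := genFun_canAdd he.lt_of_cellRel (e p) q
    have h : qNumber q (a + b) * genFun q (fun w => IsCutLinExt (cellRel e) w ∧
          CanRemove (cellRel e) (e p) w) =
        (qNumber q (a + b) + q * cornerCoeff q a b p.1.1 p.1.2) *
          genFun q (fun w => IsCutLinExt (cellRel e) w ∧ CanRemove (cellRel e) (e p) w) -
        cornerCoeff q a b p.1.1 p.1.2 *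
          genFun q (fun w => IsCutLinExt (cellRel e) w ∧ CanAdd (cellRel e) (e p) w) := by
      rw [htog]; ring
    rw [h, genFun, genFun, mul_sum, mul_sum, ← sum_sub_distrib]
    refine sum_congr rfl fun w _ => ?_
    by_cases h1 : IsCutLinExt (cellRel e) w <;> by_cases h2 : CanRemove (cellRel e) (e p) w <;>
      by_cases h3 : CanAdd (cellRel e) (e p) w <;> simp [h1, h2, h3] <;> ring
  rw [mul_sum, sum_congr rfl fun p _ => hterm p, sum_comm, genFun, mul_sum]
  refine sum_congr rfl fun w _ => ?_
  by_cases hw : IsCutLinExt (cellRel e) w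
  · simp only [if_pos hw]
    rw [← mul_sum, hsplit w hw, mul_comm]
  · simp [hw]

theorem qNumber_X_ne_zero {k : ℕ} (hk : 1 ≤ k) : qNumber (RatFunc.X : RatFunc ℚ) k ≠ 0 := by
  have h : qNumber (RatFunc.X : RatFunc ℚ) k =
      algebraMap (Polynomial ℚ) (RatFunc ℚ) (qNumber Polynomial.X k) := by
    rw [map_qNumber (algebraMap (Polynomial ℚ) (RatFunc ℚ)), RatFunc.algebraMap_X]
  rw [h, map_ne_zero_iff _ (RatFunc.algebraMap_injective ℚ)]
  intro h0
  have h1 := map_qNumber (Polynomial.evalRingHom (1 : ℚ)) Polynomial.X k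
  rw [h0] at h1
  have h2 : (k : ℚ) = 0 := by simpa [qNumber] using h1.symm
  exact absurd (Nat.cast_eq_zero.1 h2) (by omega)

end BarelySetValued

/-- An identity of rational functions over `ℚ` in the formal variable `q = RatFunc.X`. -/
theorem theorem1p1 (a b : ℕ) (ha : 1 ≤ a) (hb : 1 ≤ b) :
    ∑ S ∈ BarelySetValued.BarelySYT (BarelySetValued.rect a b),
        (RatFunc.X : RatFunc ℚ) ^ BarelySetValued.barelyComaj S =
      BarelySetValued.qNumber (RatFunc.X : RatFunc ℚ) a *
          BarelySetValued.qNumber (RatFunc.X : RatFunc ℚ) b /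
          BarelySetValued.qNumber (RatFunc.X : RatFunc ℚ) (a + b) *
        BarelySetValued.qNumber (RatFunc.X : RatFunc ℚ) (a * b + 1) *
        ∑ T ∈ BarelySetValued.SYT (BarelySetValued.rect a b),
          (RatFunc.X : RatFunc ℚ) ^ BarelySetValued.comaj T := by
  obtain ⟨e, he⟩ := BarelySetValued.exists_isRowReading (BarelySetValued.rect a b)
  have hcard : (BarelySetValued.rect a b).card = a * b := by
    simp [YoungDiagram.card, BarelySetValued.rect]
  have h := BarelySetValued.sum_genFun_canRemove (RatFunc.X : RatFunc ℚ) ha he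
  rw [BarelySetValued.genFun_cut he.lt_of_cellRel] at h
  rw [BarelySetValued.sum_BarelySYT he, BarelySetValued.sum_SYT he, ← hcard]
  have hne := BarelySetValued.qNumber_X_ne_zero (show 1 ≤ a + b by omega)
  rw [div_mul_eq_mul_div, div_mul_eq_mul_div, eq_div_iff hne]
  linear_combination h
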